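/- Let $Q$ and $\Sigma$ be disjoint finite sets and let $\mathbf M=\langle Q\cup\Sigma\cup\{0\};\cdot\rangle$ be the finite automatic algebra of a partial automaton with state set $Q$ and alphabet $\Sigma$: $0\notin Q\cup\Sigma$, for $q,r\in Q$ and $a\in\Sigma$ we have $q\cdot a=r$ if and only if there is a transition $q\xrightarrow{a}r$, and all other products equal $0$. A component of $\mathbf M$ is a connected component of the graph on $Q$ in which $q\sim r$ if and only if $q\cdot a=r$ or $r\cdot a=q$ for some $a\in\Sigma$. Let $m>1$ be an integer and assume that (a) each $a\in\Sigma$ acts as a permutation $\rho_a$ of $Q$; (b) the permutations in $\{\rho_a\mid a\in\Sigma\}$ commute; (c) there are $b,c\in\Sigma$ such that the permutation $\rho_b\rho_c^{-1}$ of $Q$ has order $m$; (d) for each component $C$ of $\mathbf M$, there is no non-trivial subgroup $H$ of the symmetric group $S_C$ such that $|H|$ divides $m$ and the set $\{\rho_a|_C\mid a\in\Sigma\}$ contains a coset of $H$. Then $\mathbf M$ is non-dualizable. Here a finite algebra $\mathbf M$ is dualizable if there is a structure on the set $M$, consisting of finitary operations, partial operations and relations that are compatible with $\mathbf M$ (relations,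 and graphs of operations and partial operations, are subuniverses of finite powers of $\mathbf M$) together with the discrete topology, such that for every algebra $\mathbf A$ that is isomorphic to a subalgebra of a power of $\mathbf M$, every continuous structure-preserving map $\varphi\colon\hom(\mathbf A,\mathbf M)\to M$ is evaluation $x\mapsto x(a)$ at a unique $a\in A$, where $\hom(\mathbf A,\mathbf M)\subseteq M^A$ carries the pointwise structure and the topology inherited from the product topology. -/

import Mathlib

open scoped Pointwise

universe u v

/-! ## Natural dualities for algebras with one binary operation

An algebra with one binary operation is a type with a `Mul` instance (no laws are assumed);
homomorphisms are `A →ₙ* M`, and powers `I → M` carry the pointwise operation. -/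

section Duality

/-- `A` belongs to `ISP(M)`: it is isomorphic to a subalgebra of a power of `M`. -/
def InISP (M A : Type u) [Mul M] [Mul A] : Prop :=
  ∃ (I : Type u) (f : A →ₙ* (I → M)), Function.Injective f

/-- An `n`-ary relation on `M` is compatible with `M` if it is a subuniverse of `M ^ n`. -/
def CompatibleRel {M : Type u} [Mul M] {n : ℕ} (r : Set (Fin n → M)) : Prop :=
  ∀ x ∈ r, ∀ y ∈ r, x * y ∈ r

/-- An `n`-ary partial operation on `M` is compatible with `M` if its graph is closed under the
operation of `M`. -/
def CompatiblePartialOp {M : Type u} [Mul M] {n : ℕ} (h : (Fin n → M) →. M) : Prop :=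
  ∀ (x y : Fin n → M) (s t : M), s ∈ h x → t ∈ h y → s * t ∈ h (x * y)

/-- An `n`-ary total operation on `M` is compatible with `M` if it is a homomorphism
`M ^ n → M`. -/
def CompatibleOp {M : Type u} [Mul M] {n : ℕ} (g : (Fin n → M) → M) : Prop :=
  ∀ x y : Fin n → M, g (x * y) = g x * g y

/-- An alter ego of `M`: a structure on the carrier of `M` given by arbitrary sets of finitary
operations, finitary partial operations and finitary relations, all compatible with `M`.
The topology of the alter ego is the discrete one. -/
structure AlterEgo (M : Type u) [Mul M] where
  ops : ∀ n : ℕ, Set ((Fin n → M) → M)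
  partialOps : ∀ n : ℕ, Set ((Fin n → M) →. M)
  rels : ∀ n : ℕ, Set (Set (Fin n → M))
  compatible_ops : ∀ n, ∀ g ∈ ops n, CompatibleOp g
  compatible_partialOps : ∀ n, ∀ h ∈ partialOps n, CompatiblePartialOp h
  compatible_rels : ∀ n, ∀ r ∈ rels n, CompatibleRel r

/-- The topology on the dual `hom(A, M)`: the subspace topology from the product `M ^ A` of
discrete spaces. -/
@[reducible] def homTopology (A M : Type u) [Mul A] [Mul M] : TopologicalSpace (A →ₙ* M) :=
  TopologicalSpace.induced (fun x : A →ₙ* M => (x : A → M))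
    (@Pi.topologicalSpace A (fun _ => M) (fun _ => ⊥))

/-- `φ` is a morphism from the dual `hom(A, M)`, as a topological substructure of the power
`E ^ A` of the alter ego `E`, to `E` itself: it is continuous and preserves all operations,
partial operations and relations of `E`, which are interpreted pointwise on `hom(A, M)`. -/
structure AlterEgo.IsMorphism {M : Type u} [Mul M] (E : AlterEgo M) {A : Type u} [Mul A]
    (φ : (A →ₙ* M) → M) : Prop where
  continuous : @Continuous (A →ₙ* M) M (homTopology A M) ⊥ φ
  map_op : ∀ n, ∀ g ∈ E.ops n, ∀ (x : Fin n → (A →ₙ* M)) (y : A →ₙ* M),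
    (∀ a, y a = g (fun i => x i a)) → φ y = g (fun i => φ (x i))
  map_partialOp : ∀ n, ∀ h ∈ E.partialOps n, ∀ (x : Fin n → (A →ₙ* M)) (y : A →ₙ* M),
    (∀ a, y a ∈ h (fun i => x i a)) → φ y ∈ h (fun i => φ (x i))
  map_rel : ∀ n, ∀ r ∈ E.rels n, ∀ x : Fin n → (A →ₙ* M),
    (∀ a, (fun i => x i a) ∈ r) → (fun i => φ (x i)) ∈ r

/-- The alter ego `E` yields a duality on `ISP(M)`: for every algebra `A` in `ISP(M)`, the
evaluation map from `A` to the algebra of morphisms `hom(A, M) → E` is a bijection, that is,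
each morphism is the evaluation at exactly one element of `A`. (Algebras are non-empty.) -/
def AlterEgo.YieldsDuality {M : Type u} [Mul M] (E : AlterEgo M) : Prop :=
  ∀ (A : Type u) [Mul A] [Nonempty A], InISP M A →
    ∀ φ : (A →ₙ* M) → M, E.IsMorphism φ → ∃! a : A, ∀ x : A →ₙ* M, φ x = x a

/-- The (finite) algebra `M` is dualizable: some alter ego of `M` yields a duality on
`ISP(M)`. -/
def Dualizable (M : Type u) [Mul M] : Prop :=
  ∃ E : AlterEgo M, E.YieldsDuality

end Duality

/-! ## Automatic algebras -/

section Automatic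

/-- The carrier `Q ∪ S ∪ {0}` (a disjoint union) of the automatic algebra of a partial automaton
with state set `Q`, alphabet `S` and partial transition function `step`. -/
inductive AutomaticAlgebra {Q : Type u} {S : Type v} (step : Q → S → Option Q) : Type (max u v)
  | state (q : Q) : AutomaticAlgebra step
  | letter (a : S) : AutomaticAlgebra step
  | zero : AutomaticAlgebra step

/-- The product of an automatic algebra: `q · a = r` if there is a transition from `q` to `r`
labelled `a`, and all other products are the default element. -/
def AutomaticAlgebra.mul {Q : Type u} {S : Type v} {step : Q → S → Option Q} :
    AutomaticAlgebra step → AutomaticAlgebra step → AutomaticAlgebra step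
  | .state q, .letter a =>
    match step q a with
    | some r => .state r
    | none => .zero
  | _, _ => .zero

instance {Q : Type u} {S : Type v} (step : Q → S → Option Q) : Mul (AutomaticAlgebra step) :=
  ⟨AutomaticAlgebra.mul⟩

/-- The underlying graph of a partial automaton: states `q ≠ r` are adjacent if some letter sends
one of them to the other. (Loops do not affect the connected components.) -/
def stateGraph {Q : Type u} {S : Type v} (step : Q → S → Option Q) : SimpleGraph Q :=
  SimpleGraph.fromRel (fun q r => ∃ a, step q a = some r)

/-- The permutations of a set `C` of states that are the restriction to `C` of the action of some
letter. -/
def letterActions {Q : Type u} {S : Type v} (step : Q → S → Option Q) (C : Set Q) :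
    Set (Equiv.Perm C) :=
  {σ | ∃ a, ∀ q : C, step q a = some (σ q : Q)}

end Automatic

/-! ### Ghost elements -/

section Ghost

/-! The proof is a ghost element argument. Put δ = ρ_b ρ_c⁻¹. In `tupleAlgebra`, state tuples carry
an exponent vector e of degree 1 mod m, entering through δ ^ e(j), and letter tuples subtract 1_F
with m ∣ #F. The terms with e = 1_j converge coordinatewise to the tuple with e = 0, whose degree is
wrong, so it lies outside the algebra.

By `not_dualizable_of_ghost` it remains to bound uniformly the exceptional terms of each
homomorphism (`exists_majority`). Otherwise some value w ≠ v is taken at more than m indices, where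
v is taken infinitely often. Exchanging a v-index for a w-index in a letter set F changes its letter
by one fixed permutation h of the component, since a commuting group acts there semiregularly. As δ
^ m = 1, also h ^ m = 1 on the component. Starting from m v-indices and exchanging them one at a
time gives letters acting as g h ^ r for r = 0, …, m: a coset of ⟨h⟩, which (d) forbids. -/

/-- If every homomorphism `x : A → M` takes the same value `v x` at all but at most `N` terms of
the sequence `t`, then `v` is a morphism for every alter ego of `M`; so `M` is not dualizable
unless `v` is an evaluation. -/
theorem not_dualizable_of_ghost {M A : Type u} [Mul M] [Mul A] [Nonempty A] (hA : InISP M A)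
    (t : ℕ → A) (N : ℕ) (v : (A →ₙ* M) → M)
    (hv : ∀ x, ∀ D : Finset ℕ, (∀ j ∈ D, x (t j) ≠ v x) → D.card ≤ N)
    (hg : ¬ ∃ a, ∀ x : A →ₙ* M, v x = x a) : ¬ Dualizable M := by
  rintro ⟨E, hE⟩
  have hev : ∀ x, ∀ᶠ j in Filter.cofinite, v x = x (t j) := by
    intro x
    rw [Filter.eventually_cofinite]
    by_contra hinf
    obtain ⟨D, hD, hcard⟩ := Set.Infinite.exists_subset_card_eq hinf (N + 1)
    have := hv x D fun j hj => Ne.symm (hD hj)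
    omega
  have hall : ∀ n (x : Fin n → (A →ₙ* M)), ∀ᶠ j in Filter.cofinite, ∀ i, v (x i) = x i (t j) :=
    fun n x => Filter.eventually_all.2 fun i => hev (x i)
  refine hg (hE A hA v ?_).exists
  refine ⟨?_, ?_, ?_, ?_⟩
  · let _ : TopologicalSpace M := ⊥
    have : DiscreteTopology M := ⟨rfl⟩
    let _ : TopologicalSpace (A →ₙ* M) := homTopology A M
    have hco : ∀ a : A, Continuous fun x : A →ₙ* M => x a := fun a =>
      (continuous_apply a).comp continuous_induced_dom
    refine continuous_discrete_rng.2 fun w => isOpen_iff_forall_mem_open.2 fun x hx => ?_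
    -- Two exceptional sets of size at most `N` cannot cover `2 * N + 1` indices, so agreement with
    -- `x` at these terms forces `v y = v x`.
    refine ⟨⋂ j ∈ Finset.range (2 * N + 1), {y | y (t j) = x (t j)}, ?_, ?_, ?_⟩
    · intro y hy
      simp only [Set.mem_iInter, Set.mem_ofPred_eq] at hy
      classical
      have h1 := hv x {j ∈ Finset.range (2 * N + 1) | x (t j) ≠ v x} (by simp)
      have h2 := hv y {j ∈ Finset.range (2 * N + 1) | y (t j) ≠ v y} (by simp)
      have h3 := Finset.card_union_le {j ∈ Finset.range (2 * N + 1) | x (t j) ≠ v x}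
        {j ∈ Finset.range (2 * N + 1) | y (t j) ≠ v y}
      obtain ⟨j, hj, hj'⟩ := Finset.exists_mem_notMem_of_card_lt_card
        (s := {j ∈ Finset.range (2 * N + 1) | x (t j) ≠ v x} ∪
          {j ∈ Finset.range (2 * N + 1) | y (t j) ≠ v y}) (t := Finset.range (2 * N + 1))
        (by rw [Finset.card_range]; omega)
      simp only [Finset.mem_union, Finset.mem_filter, hj, true_and, not_or, not_not] at hj'
      have hx' : v x = w := hx
      change v y = w
      rw [← hj'.2, hy j hj, hj'.1, hx']
    · refine isOpen_biInter_finset fun j _ => ?_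
      exact (isOpen_discrete {x (t j)}).preimage (hco (t j))
    · simp
  -- Finitely many homomorphisms share a good index `j`, so on them `v` is evaluation at `t j`. The
  -- same works for partial operations and relations.
  · intro n g _ x y hxy
    obtain ⟨j, hj, hj'⟩ := ((hall n x).and (hev y)).exists
    simp only [hj, hj', hxy]
  · intro n g _ x y hxy
    obtain ⟨j, hj, hj'⟩ := ((hall n x).and (hev y)).exists
    simp only [hj, hj', hxy]
  · intro n g _ x hxy
    obtain ⟨j, hj⟩ := (hall n x).exists
    simp only [hj, hxy]

end Ghost

/-! ### Families of commuting permutations -/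

section CommutingPerms

variable {Q : Type u} {S : Type v} {ρ : S → Equiv.Perm Q}

theorem commute_of_mem_closure_range (hb : ∀ a a' : S, Commute (ρ a) (ρ a'))
    {σ τ : Equiv.Perm Q} (hσ : σ ∈ Subgroup.closure (Set.range ρ))
    (hτ : τ ∈ Subgroup.closure (Set.range ρ)) : Commute σ τ := by
  have h1 : ∀ a, ∀ τ ∈ Subgroup.closure (Set.range ρ), Commute (ρ a) τ := by
    intro a τ hτ
    induction hτ using Subgroup.closure_induction with
    | mem x hx => obtain ⟨a', rfl⟩ := hx; exact hb a a'
    | one => exact Commute.one_right _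
    | mul x y _ _ hx hy => exact hx.mul_right hy
    | inv x _ hx => exact hx.inv_right
  induction hσ using Subgroup.closure_induction with
  | mem x hx => obtain ⟨a, rfl⟩ := hx; exact h1 a τ hτ
  | one => exact Commute.one_left _
  | mul x y _ _ hx hy => exact hx.mul_left hy
  | inv x _ hx => exact hx.inv_left

theorem exists_apply_eq_of_reachable {step : Q → S → Option Q}
    (ha : ∀ (a : S) (q : Q), step q a = some (ρ a q)) {p q : Q}
    (h : (stateGraph step).Reachable p q) :
    ∃ σ ∈ Subgroup.closure (Set.range ρ), σ p = q := by
  obtain ⟨w⟩ := h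
  induction w with
  | nil => exact ⟨1, one_mem _, rfl⟩
  | cons hadj _ ih =>
    obtain ⟨σ, hσ, rfl⟩ := ih
    rw [stateGraph, SimpleGraph.fromRel_adj] at hadj
    obtain ⟨-, ⟨a, h⟩ | ⟨a, h⟩⟩ := hadj <;> rw [ha, Option.some_inj] at h
    · exact ⟨σ * ρ a, mul_mem hσ (Subgroup.subset_closure ⟨a, rfl⟩), by simp [h]⟩
    · exact ⟨σ * (ρ a)⁻¹, mul_mem hσ (inv_mem (Subgroup.subset_closure ⟨a, rfl⟩)),
        by simp [← h]⟩

theorem reachable_apply {step : Q → S → Option Q}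
    (ha : ∀ (a : S) (q : Q), step q a = some (ρ a q)) {σ : Equiv.Perm Q}
    (hσ : σ ∈ Subgroup.closure (Set.range ρ)) (q : Q) : (stateGraph step).Reachable q (σ q) := by
  induction hσ using Subgroup.closure_induction generalizing q with
  | mem x hx =>
    obtain ⟨a, rfl⟩ := hx
    by_cases h : q = ρ a q
    · rw [← h]
    · refine SimpleGraph.Adj.reachable ?_
      rw [stateGraph, SimpleGraph.fromRel_adj]
      exact ⟨h, Or.inl ⟨a, ha a q⟩⟩
  | one => exact SimpleGraph.Reachable.refl q
  | mul x y _ _ hx hy => exact (hy q).trans (hx (y q))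
  | inv x _ hx => simpa using (hx (x⁻¹ q)).symm

/-- Two elements of the group generated by the letters that agree at a state agree on its whole
component. -/
theorem apply_eq_of_reachable {step : Q → S → Option Q}
    (ha : ∀ (a : S) (q : Q), step q a = some (ρ a q)) (hb : ∀ a a' : S, Commute (ρ a) (ρ a'))
    {σ τ : Equiv.Perm Q} (hσ : σ ∈ Subgroup.closure (Set.range ρ))
    (hτ : τ ∈ Subgroup.closure (Set.range ρ)) {p q : Q}
    (hpq : (stateGraph step).Reachable p q) (h : σ p = τ p) : σ q = τ q := by
  obtain ⟨π, hπ, rfl⟩ := exists_apply_eq_of_reachable ha hpq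
  rw [← Equiv.Perm.mul_apply, ← Equiv.Perm.mul_apply,
    (commute_of_mem_closure_range hb hσ hπ).eq, (commute_of_mem_closure_range hb hτ hπ).eq,
    Equiv.Perm.mul_apply, Equiv.Perm.mul_apply, h]

/-- A component on which the letters contain all `ρ a₀ * h ^ r`, where `h ^ m = 1` and `h ≠ 1`,
admits a non-trivial subgroup of order dividing `m` with a coset contained in the letters. -/
theorem exists_subgroup_of_powers {step : Q → S → Option Q}
    (ha : ∀ (a : S) (q : Q), step q a = some (ρ a q)) (hb : ∀ a a' : S, Commute (ρ a) (ρ a'))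
    {m : ℕ} (hm : 0 < m) {h : Equiv.Perm Q} (hh : h ∈ Subgroup.closure (Set.range ρ)) {p : Q}
    (hp : h p ≠ p) (hpm : (h ^ m) p = p) {a : ℕ → S} {q : Q}
    (hpq : (stateGraph step).Reachable p q)
    (haq : ∀ r < m, ρ (a r) q = ρ (a 0) ((h ^ r) q)) :
    ∃ C : (stateGraph step).ConnectedComponent, ∃ H : Subgroup (Equiv.Perm C.supp),
      H ≠ ⊥ ∧ Nat.card H ∣ m ∧
        ∃ g : Equiv.Perm C.supp, g • (H : Set (Equiv.Perm C.supp)) ⊆ letterActions step C.supp := by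
  set C := (stateGraph step).connectedComponentMk p with hC
  have hmem : ∀ x, x ∈ C.supp ↔ (stateGraph step).Reachable p x := fun x => by
    rw [SimpleGraph.ConnectedComponent.mem_supp_iff, hC, SimpleGraph.ConnectedComponent.eq]
    exact ⟨fun h => h.symm, fun h => h.symm⟩
  have hst : ∀ σ ∈ Subgroup.closure (Set.range ρ), ∀ x, σ x ∈ C.supp ↔ x ∈ C.supp := by
    intro σ hσ x
    rw [hmem, hmem]
    exact ⟨fun h => h.trans (reachable_apply ha hσ x).symm,
      fun h => h.trans (reachable_apply ha hσ x)⟩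
  have hgen : ∀ a, ρ a ∈ Subgroup.closure (Set.range ρ) := fun a => Subgroup.subset_closure ⟨a, rfl⟩
  set η : Equiv.Perm C.supp := h.subtypePerm (hst h hh) with hη
  have hηm : η ^ m = 1 := by
    ext ⟨x, hx⟩
    rw [hη, Equiv.Perm.subtypePerm_pow]
    exact apply_eq_of_reachable ha hb (pow_mem hh m) (one_mem _) ((hmem x).1 hx) hpm
  refine ⟨C, Subgroup.zpowers η, ?_, ?_, (ρ (a 0)).subtypePerm (hst _ (hgen _)), ?_⟩
  · rw [Ne, Subgroup.zpowers_eq_bot]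
    intro h1
    have := congrArg (fun σ : Equiv.Perm C.supp =>
      (σ ⟨p, (hmem p).2 (SimpleGraph.Reachable.refl p)⟩ : Q)) h1
    exact hp this
  · rw [Nat.card_zpowers]
    exact orderOf_dvd_of_pow_eq_one hηm
  · rintro _ ⟨_, ⟨z, rfl⟩, rfl⟩
    -- `haq` only covers exponents below `m`.
    have hz : η ^ z = η ^ (z % m).toNat := by
      have h0 : 0 ≤ z % (m : ℤ) := Int.emod_nonneg _ (by omega)
      rw [← zpow_natCast, Int.toNat_of_nonneg h0]
      conv_lhs => rw [← Int.mul_ediv_add_emod z m]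
      rw [zpow_add, zpow_mul, zpow_natCast, hηm, one_zpow, one_mul]
    have hlt : (z % m).toNat < m := by
      have := Int.emod_lt_of_pos z (by omega : (0 : ℤ) < m)
      omega
    refine ⟨a (z % m).toNat, fun x => ?_⟩
    rw [ha, Option.some_inj]
    change _ = (((ρ (a 0)).subtypePerm (hst _ (hgen _)) * η ^ z) x : Q)
    rw [hz, hη, Equiv.Perm.subtypePerm_pow]
    refine apply_eq_of_reachable (τ := ρ (a 0) * h ^ (z % m).toNat) ha hb (hgen _)
      (mul_mem (hgen _) (pow_mem hh _)) (hpq.symm.trans ((hmem x).1 x.2)) ?_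
    exact haq _ hlt

end CommutingPerms

/-! ### Algebras of tuples over an automatic algebra of commuting permutations -/

section Tuples

namespace AutomaticAlgebra

variable {Q : Type u} {S : Type v} {step : Q → S → Option Q} {ρ : S → Equiv.Perm Q}

theorem state_mul_letter (ha : ∀ (a : S) (q : Q), step q a = some (ρ a q)) (q : Q) (a : S) :
    (state q : AutomaticAlgebra step) * letter a = state (ρ a q) := by
  change AutomaticAlgebra.mul _ _ = _
  simp [AutomaticAlgebra.mul, ha]

theorem state_mul_state (q r : Q) : (state q : AutomaticAlgebra step) * state r = zero := rfl

theorem state_mul_zero (q : Q) : (state q : AutomaticAlgebra step) * zero = zero := rfl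

theorem letter_mul (a : S) (x : AutomaticAlgebra step) : letter a * x = zero := rfl

theorem zero_mul (x : AutomaticAlgebra step) : zero * x = zero := rfl

theorem mul_eq_state (ha : ∀ (a : S) (q : Q), step q a = some (ρ a q))
    {x y : AutomaticAlgebra step} {r : Q} (h : x * y = state r) :
    ∃ q a, x = state q ∧ y = letter a ∧ ρ a q = r := by
  rcases x with q | a | _
  · rcases y with q' | a | _
    · rw [state_mul_state] at h; cases h
    · rw [state_mul_letter ha] at h
      exact ⟨q, a, rfl, rfl, by cases h; rfl⟩
    · rw [state_mul_zero] at h; cases h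
  · rw [letter_mul] at h; cases h
  · rw [zero_mul] at h; cases h

theorem mul_eq_state_or_zero (ha : ∀ (a : S) (q : Q), step q a = some (ρ a q))
    (x y : AutomaticAlgebra step) : (∃ q, x * y = state q) ∨ x * y = zero := by
  rcases x with q | a | _
  · rcases y with q' | a | _
    · exact Or.inr rfl
    · exact Or.inl ⟨_, state_mul_letter ha q a⟩
    · exact Or.inr rfl
  · exact Or.inr rfl
  · exact Or.inr rfl

end AutomaticAlgebra

open AutomaticAlgebra

/-- The indicator function of a finite set. -/
noncomputable def finsetIndicator (F : Finset ℕ) : ℕ →₀ ℤ := ∑ i ∈ F, Finsupp.single i 1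

theorem degree_finsetIndicator (F : Finset ℕ) :
    Finsupp.degree (finsetIndicator F) = (F.card : ℤ) := by
  simp [finsetIndicator]

theorem finsetIndicator_apply (F : Finset ℕ) (j : ℕ) :
    finsetIndicator F j = if j ∈ F then 1 else 0 := by
  simp [finsetIndicator, Finsupp.single_apply]

theorem finsetIndicator_insert_erase {F : Finset ℕ} {i j : ℕ} (hi : i ∈ F) (hj : j ∉ F) :
    finsetIndicator (insert j (F.erase i)) =
      finsetIndicator F + Finsupp.single j 1 - Finsupp.single i 1 := by
  have hj' : j ∉ F.erase i := fun h => hj (Finset.mem_of_mem_erase h)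
  have h1 : finsetIndicator F = Finsupp.single i 1 + finsetIndicator (F.erase i) :=
    (Finset.add_sum_erase F _ hi).symm
  rw [h1, finsetIndicator, Finset.sum_insert hj', ← finsetIndicator]
  abel

theorem card_insert_erase {F : Finset ℕ} {i j : ℕ} (hi : i ∈ F) (hj : j ∉ F) :
    (insert j (F.erase i)).card = F.card := by
  have hj' : j ∉ F.erase i := fun h => hj (Finset.mem_of_mem_erase h)
  rw [Finset.card_insert_of_notMem hj', Finset.card_erase_add_one hi]

/-! ### Values of a homomorphism on the tuples -/

variable {Q : Type u} {S : Type v} {step : Q → S → Option Q} {ρ : S → Equiv.Perm Q} {m : ℕ}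

/-- Suppose letters indexed by finite sets `F` with `m ∣ #F` act on states indexed by `k` and `e`
by `(k, e) ↦ (k + 1, e - 1_F)`. If the state with index `(0, 1_0)` is not zero, then the states
are permuted by the group generated by the letters when `e` is replaced by `e + 1_j - 1_i`. -/
theorem exists_perm_swap (ha : ∀ (a : S) (q : Q), step q a = some (ρ a q)) (hm : 0 < m)
    {y : ℤ → (ℕ →₀ ℤ) → AutomaticAlgebra step} {a : Finset ℕ → S}
    (hmul : ∀ k e F, (m : ℤ) ∣ e.degree - 1 → m ∣ F.card →
      y k e * letter (a F) = y (k + 1) (e - finsetIndicator F)) {i j : ℕ} (hij : i ≠ j) :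
    ∃ σ ∈ Subgroup.closure (Set.range ρ), ∀ k e p, (m : ℤ) ∣ e.degree - 1 → y k e = state p →
      y k (e + Finsupp.single j 1 - Finsupp.single i 1) = state (σ p) := by
  obtain ⟨F, hjF, hiF, hcard⟩ : ∃ F : Finset ℕ, j ∈ F ∧ i ∉ F ∧ F.card = m := by
    obtain ⟨F, hF, hcard⟩ := Set.Infinite.exists_subset_card_eq
      (Set.Finite.infinite_compl (Set.toFinite ({i, j} : Set ℕ))) (m - 1)
    have hF' : ∀ x ∈ F, x ≠ i ∧ x ≠ j := fun x hx => by simpa using hF hx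
    refine ⟨insert j F, by simp, ?_, ?_⟩
    · rw [Finset.mem_insert, not_or]
      exact ⟨hij, fun h => (hF' i h).1 rfl⟩
    · rw [Finset.card_insert_of_notMem fun h => (hF' j h).2 rfl]
      omega
  set F' := insert i (F.erase j) with hF'
  have hcard' : F'.card = m := by rw [hF', card_insert_erase hjF hiF, hcard]
  have hgen : ∀ a, ρ a ∈ Subgroup.closure (Set.range ρ) := fun a => Subgroup.subset_closure ⟨a, rfl⟩
  refine ⟨(ρ (a F))⁻¹ * ρ (a F'), mul_mem (inv_mem (hgen _)) (hgen _), fun k e p he hy => ?_⟩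
  have h1 := hmul k e F' he (by rw [hcard'])
  have h2 := hmul k (e + Finsupp.single j 1 - Finsupp.single i 1) F (by simpa using he)
    (by rw [hcard])
  -- Hence e times F' equals e + 1_j - 1_i times F, and the letter of F can be cancelled.
  have h3 : e - finsetIndicator F' =
      e + Finsupp.single j 1 - Finsupp.single i 1 - finsetIndicator F := by
    rw [hF', finsetIndicator_insert_erase hjF hiF]
    abel
  rw [hy, state_mul_letter ha, h3, ← h2] at h1
  obtain ⟨q, a', hq, ha', hr⟩ := mul_eq_state ha h1.symm
  rw [letter.injEq] at ha'
  subst ha'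
  rw [hq, Equiv.Perm.mul_apply, ← hr, Equiv.Perm.inv_def, Equiv.symm_apply_apply]

/-- In the situation of `exists_perm_swap`, the states with index `(0, 1_j)` are constant with few
exceptions. -/
theorem exists_majority_of_state [Finite Q] (ha : ∀ (a : S) (q : Q), step q a = some (ρ a q))
    (hb : ∀ a a' : S, Commute (ρ a) (ρ a')) (hm : 0 < m)
    (hd : ∀ C : (stateGraph step).ConnectedComponent,
      ¬ ∃ H : Subgroup (Equiv.Perm C.supp), H ≠ ⊥ ∧ Nat.card H ∣ m ∧
        ∃ g : Equiv.Perm C.supp, g • (H : Set (Equiv.Perm C.supp)) ⊆ letterActions step C.supp)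
    {y : ℤ → (ℕ →₀ ℤ) → AutomaticAlgebra step} {a : Finset ℕ → S}
    (hmul : ∀ k e F, (m : ℤ) ∣ e.degree - 1 → m ∣ F.card →
      y k e * letter (a F) = y (k + 1) (e - finsetIndicator F))
    (hper : ∀ k e i j, y k (e + m • (Finsupp.single j 1 - Finsupp.single i 1)) = y k e)
    {p₀ : Q} (hp₀ : y 0 (Finsupp.single 0 1) = state p₀) :
    ∃ v, ∀ D : Finset ℕ, (∀ j ∈ D, y 0 (Finsupp.single j 1) ≠ v) → D.card ≤ m * Nat.card Q := by
  classical
  have := Fintype.ofFinite Q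
  have hgen : ∀ a, ρ a ∈ Subgroup.closure (Set.range ρ) := fun a => Subgroup.subset_closure ⟨a, rfl⟩
  have hp : ∀ j, ∃ p, y 0 (Finsupp.single j 1) = state p ∧ (stateGraph step).Reachable p₀ p := by
    intro j
    rcases eq_or_ne 0 j with rfl | hj
    · exact ⟨p₀, hp₀, SimpleGraph.Reachable.refl _⟩
    · obtain ⟨σ, hσ, h⟩ := exists_perm_swap ha hm hmul hj
      have := h 0 (Finsupp.single 0 1) p₀ (by simp) hp₀
      rw [add_sub_cancel_left] at this
      exact ⟨σ p₀, this, reachable_apply ha hσ p₀⟩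
  choose p hp hreach using hp
  obtain ⟨v, hv⟩ := Finite.exists_infinite_fiber p
  have hv : (p ⁻¹' {v}).Infinite := Set.infinite_coe_iff.1 hv
  refine ⟨state v, fun D hD => ?_⟩
  by_contra! hcard
  -- Pigeonhole: some value is taken at more than `m` indices of `D`.
  obtain ⟨w, -, hw⟩ := Finset.exists_lt_card_fiber_of_mul_lt_card_of_maps_to
    (s := D) (t := Finset.univ) (f := p) (n := m) (fun _ _ => Finset.mem_univ _)
    (by rw [Finset.card_univ, ← Nat.card_eq_fintype_card, mul_comm]; exact hcard)
  set K := {j ∈ D | p j = w} with hK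
  have hKw : ∀ j ∈ K, p j = w := fun j hj => (Finset.mem_filter.1 hj).2
  obtain ⟨F₀, hF₀, hF₀card⟩ := hv.exists_subset_card_eq m
  obtain ⟨i₀, hi₀⟩ := hv.nonempty
  obtain ⟨j₀, hj₀⟩ := Finset.card_pos.1 (lt_trans hm hw)
  have hi₀ : p i₀ = v := hi₀
  have hwv : w ≠ v := by
    rintro rfl
    exact hD j₀ (Finset.mem_filter.1 hj₀).1 (by rw [hp, hKw j₀ hj₀])
  have hne : ∀ i j, p i = v → j ∈ K → j ≠ i := by
    rintro i j hi hj rfl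
    exact hwv ((hKw j hj).symm.trans hi)
  obtain ⟨h, hh, hswap₀⟩ := exists_perm_swap ha hm hmul (hne i₀ j₀ hi₀ hj₀)
  have hmove : ∀ i j, y 0 (Finsupp.single j 1 + Finsupp.single i 1 - Finsupp.single j 1) =
      state (p i) := fun i j => by rw [add_sub_cancel_left, hp]
  have hhw : h w = v := by
    have := hswap₀ 0 (Finsupp.single j₀ 1) w (by simp) (by rw [hp, hKw j₀ hj₀])
    rw [hmove, hi₀] at this
    exact ((state.injEq _ _).mp this).symm
  have hreachw : (stateGraph step).Reachable p₀ w := hKw j₀ hj₀ ▸ hreach j₀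
  -- Every such exchange sends `w` to `v`, so by semiregularity it acts as `h` on the whole
  -- component, whichever `i` and `j` are used.
  have hswap : ∀ i j, p i = v → j ∈ K → ∀ k e q, (m : ℤ) ∣ e.degree - 1 →
      (stateGraph step).Reachable p₀ q → y k e = state q →
      y k (e + Finsupp.single i 1 - Finsupp.single j 1) = state (h q) := by
    intro i j hi hj k e q he hq hy
    obtain ⟨σ, hσ, hs⟩ := exists_perm_swap ha hm hmul (hne i j hi hj)
    rw [hs k e q he hy, apply_eq_of_reachable ha hb hσ hh (hreachw.symm.trans hq)]
    have := hs 0 (Finsupp.single j 1) w (by simp) (by rw [hp, hKw j hj])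
    rw [hmove, hi] at this
    rw [hhw, ← (state.injEq _ _).mp this]
  have hpow : ∀ r : ℕ, y 0 (Finsupp.single j₀ 1 +
      r • (Finsupp.single i₀ 1 - Finsupp.single j₀ 1)) = state ((h ^ r) w) := by
    intro r
    induction r with
    | zero => simp [hp, hKw j₀ hj₀]
    | succ r ih =>
      have := hswap₀ 0 _ _ (by simp) ih
      rw [pow_succ', Equiv.Perm.mul_apply, ← this]
      congr 1
      rw [succ_nsmul]
      abel
  have hhm : (h ^ m) w = w := by
    have := hpow m
    rw [hper, hp, hKw j₀ hj₀] at this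
    exact ((state.injEq _ _).mp this).symm
  -- Each step replaces a `v`-index of `F` by an index of `K`, which multiplies the action of the
  -- letter by `h`; `K` is large enough for `m` steps.
  have hFr : ∀ r ≤ m, ∃ F : Finset ℕ, F.card = m ∧ (∀ i ∈ F, p i = v ∨ i ∈ K) ∧
      (F ∩ K).card = r ∧ ρ (a F) w = ρ (a F₀) ((h ^ r) w) := by
    intro r
    induction r with
    | zero =>
      intro _
      refine ⟨F₀, hF₀card, fun i hi => Or.inl (hF₀ hi), ?_, rfl⟩
      rw [Finset.card_eq_zero, ← Finset.disjoint_iff_inter_eq_empty, Finset.disjoint_left]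
      exact fun i hi hiK => hne i i (hF₀ hi) hiK rfl
    | succ r ih =>
      intro hr
      obtain ⟨F, hFcard, hF, hFK, hFρ⟩ := ih (by omega)
      obtain ⟨i, hiF, hi⟩ := Finset.exists_mem_notMem_of_card_lt_card
        (s := F ∩ K) (t := F) (by omega)
      obtain ⟨j, hjK, hj⟩ := Finset.exists_mem_notMem_of_card_lt_card
        (s := F ∩ K) (t := K) (by omega)
      have hiK : i ∉ K := fun h => hi (Finset.mem_inter.2 ⟨hiF, h⟩)
      have hjF : j ∉ F := fun h => hj (Finset.mem_inter.2 ⟨h, hjK⟩)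
      have hiv : p i = v := (hF i hiF).resolve_right hiK
      have hcard' : (insert j (F.erase i)).card = m := by rw [card_insert_erase hiF hjF, hFcard]
      refine ⟨insert j (F.erase i), hcard', ?_, ?_, ?_⟩
      · intro x hx
        rcases Finset.mem_insert.1 hx with rfl | hx
        · exact Or.inr hjK
        · exact hF x (Finset.mem_of_mem_erase hx)
      · rw [Finset.insert_inter_of_mem hjK, Finset.erase_inter, Finset.erase_eq_of_notMem hi,
          Finset.card_insert_of_notMem hj, hFK]
      · have hw' : y 0 (Finsupp.single j₀ 1) = state w := by rw [hp, hKw j₀ hj₀]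
        have h1 := hmul 0 (Finsupp.single j₀ 1) F (by simp) (by rw [hFcard])
        have h2 := hmul 0 (Finsupp.single j₀ 1) (insert j (F.erase i)) (by simp) (by rw [hcard'])
        rw [hw', state_mul_letter ha] at h1 h2
        have h3 := hswap i j hiv hjK (0 + 1) _ _
          (by simp [degree_finsetIndicator, hFcard])
          (hreachw.trans (reachable_apply ha (hgen _) _)) h1.symm
        rw [finsetIndicator_insert_erase hiF hjF] at h2
        have h4 : (Finsupp.single j₀ 1 - (finsetIndicator F + Finsupp.single j 1 -
            Finsupp.single i 1)) = Finsupp.single j₀ 1 - finsetIndicator F + Finsupp.single i 1 -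
            Finsupp.single j 1 := by abel
        rw [h4, h3, state.injEq, hFρ] at h2
        rw [h2, pow_succ', Equiv.Perm.mul_apply, ← Equiv.Perm.mul_apply, ← Equiv.Perm.mul_apply,
          (commute_of_mem_closure_range hb hh (hgen _)).eq, Equiv.Perm.mul_apply,
          Equiv.Perm.mul_apply]
  choose! F hFcard hFK hFKcard hFρ using hFr
  -- The chosen `F 0` need not be `F₀`, but their letters agree at `w`, hence on the component.
  have hF0 : ρ (a (F 0)) w = ρ (a F₀) w := by simpa using hFρ 0 (Nat.zero_le m)
  obtain ⟨C, hC⟩ := exists_subgroup_of_powers ha hb hm hh (p := w) (by rw [hhw]; exact hwv.symm) hhm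
    (a := fun r => a (F r)) (SimpleGraph.Reachable.refl w) (fun r hr => by
      rw [hFρ r hr.le]
      exact (apply_eq_of_reachable ha hb (hgen _) (hgen _)
        (reachable_apply ha (pow_mem hh r) w) hF0).symm)
  exact hd C hC

/-- Each term is a product with every admissible letter tuple, so one term with a state as value
forces all admissible `z F` to be letters. If there is no such term, all values are zero. -/
theorem exists_majority [Finite Q] (ha : ∀ (a : S) (q : Q), step q a = some (ρ a q))
    (hb : ∀ a a' : S, Commute (ρ a) (ρ a')) (hm : 0 < m)
    (hd : ∀ C : (stateGraph step).ConnectedComponent,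
      ¬ ∃ H : Subgroup (Equiv.Perm C.supp), H ≠ ⊥ ∧ Nat.card H ∣ m ∧
        ∃ g : Equiv.Perm C.supp, g • (H : Set (Equiv.Perm C.supp)) ⊆ letterActions step C.supp)
    {y : ℤ → (ℕ →₀ ℤ) → AutomaticAlgebra step} {z : Finset ℕ → AutomaticAlgebra step}
    (hmul : ∀ k e F, (m : ℤ) ∣ e.degree - 1 → m ∣ F.card →
      y k e * z F = y (k + 1) (e - finsetIndicator F))
    (hper : ∀ k e i j, y k (e + m • (Finsupp.single j 1 - Finsupp.single i 1)) = y k e) :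
    ∃ v, ∀ D : Finset ℕ, (∀ j ∈ D, y 0 (Finsupp.single j 1) ≠ v) → D.card ≤ m * Nat.card Q := by
  -- The index `-1` is where integer `k`, rather than natural `k`, is needed.
  have hback : ∀ j F, m ∣ F.card → y (-1) (Finsupp.single j 1 + finsetIndicator F) * z F =
      y 0 (Finsupp.single j 1) := by
    intro j F hF
    rw [hmul _ _ F _ hF, add_sub_cancel_right]
    · rfl
    · simpa [degree_finsetIndicator] using (Int.natCast_dvd_natCast.2 hF)
  by_cases hst : ∃ j p, y 0 (Finsupp.single j 1) = state p
  · obtain ⟨j, p, hp⟩ := hst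
    have hz : ∀ F : Finset ℕ, ∃ a, m ∣ F.card → z F = letter a := by
      intro F
      by_cases hF : m ∣ F.card
      · obtain ⟨-, a, -, h, -⟩ := mul_eq_state ha ((hback j F hF).trans hp)
        exact ⟨a, fun _ => h⟩
      · obtain ⟨-, a, -, -, -⟩ := mul_eq_state ha ((hback j ∅ (by simp)).trans hp)
        exact ⟨a, fun h => absurd h hF⟩
    choose a hz using hz
    have hmul' : ∀ k e F, (m : ℤ) ∣ e.degree - 1 → m ∣ F.card →
        y k e * letter (a F) = y (k + 1) (e - finsetIndicator F) := fun k e F he hF => by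
      rw [← hz F hF, hmul k e F he hF]
    obtain ⟨p₀, hp₀⟩ : ∃ p₀, y 0 (Finsupp.single 0 1) = state p₀ := by
      rcases eq_or_ne j 0 with rfl | hj
      · exact ⟨p, hp⟩
      · obtain ⟨σ, -, hs⟩ := exists_perm_swap ha hm hmul' hj
        have := hs 0 _ p (by simp) hp
        rw [add_sub_cancel_left] at this
        exact ⟨_, this⟩
    exact exists_majority_of_state ha hb hm hd hmul' hper hp₀
  · refine ⟨zero, fun D hD => ?_⟩
    rcases D.eq_empty_or_nonempty with rfl | ⟨j, hj⟩
    · simp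
    · rcases mul_eq_state_or_zero ha (y (-1) (Finsupp.single j 1 + finsetIndicator ∅)) (z ∅) with
        ⟨q, hq⟩ | h0
      · exact absurd ⟨j, q, (hback j ∅ (by simp)).symm.trans hq⟩ hst
      · exact absurd ((hback j ∅ (by simp)).symm.trans h0) (hD j hj)

/-! ### The algebra of tuples -/

/-- The tuple of states `ρ_b ^ k (ρ_b ρ_c⁻¹) ^ (e j) q`. -/
noncomputable def stateTuple (step : Q → S → Option Q) (ρ : S → Equiv.Perm Q) (b c : S) (k : ℤ)
    (e : ℕ →₀ ℤ) : ℕ × Q → AutomaticAlgebra step :=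
  fun i => state ((ρ b ^ k * (ρ b * (ρ c)⁻¹) ^ e i.1) i.2)

open Classical in
/-- The tuple with letter `c` at the coordinates in `F` and letter `b` elsewhere. -/
noncomputable def letterTuple (step : Q → S → Option Q) (b c : S) (F : Finset ℕ) :
    ℕ × Q → AutomaticAlgebra step :=
  fun i => letter (if i.1 ∈ F then c else b)

/-- Since ρ_c = ρ_b δ⁻¹, a letter `c` differs from `b` only in lowering the exponent of δ by one. -/
theorem stateTuple_mul_letterTuple (ha : ∀ (a : S) (q : Q), step q a = some (ρ a q))
    (hb : ∀ a a' : S, Commute (ρ a) (ρ a')) (b c : S) (k : ℤ) (e : ℕ →₀ ℤ) (F : Finset ℕ) :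
    stateTuple step ρ b c k e * letterTuple step b c F =
      stateTuple step ρ b c (k + 1) (e - finsetIndicator F) := by
  funext ⟨j, q⟩
  have hbd : Commute (ρ b) (ρ b * (ρ c)⁻¹) := (Commute.refl _).mul_right (hb b c).inv_right
  simp only [Pi.mul_apply, stateTuple, letterTuple, state_mul_letter ha, state.injEq,
    Finsupp.sub_apply, finsetIndicator_apply, ← Equiv.Perm.mul_apply]
  congr 1
  split_ifs
  · have hc : ρ c = ρ b * (ρ b * (ρ c)⁻¹)⁻¹ := by
      rw [mul_inv_rev, inv_inv, ← mul_assoc, (hb b c).eq, mul_inv_cancel_right]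
    generalize ρ b * (ρ c)⁻¹ = δ at hbd hc ⊢
    rw [hc, add_comm, zpow_one_add, sub_eq_neg_add, zpow_add, zpow_neg_one, mul_assoc, mul_assoc,
      ← mul_assoc (_⁻¹) (ρ b ^ k), (hbd.symm.inv_left.zpow_right k).eq, mul_assoc]
  · rw [sub_zero, add_comm, zpow_one_add, mul_assoc]

/-- The subalgebra of `M ^ (ℕ × Q)` that consists of the zero tuple, the tuples `stateTuple` with
exponents of degree `1` modulo `m`, and the tuples `letterTuple` for sets of size `0` modulo `m`. -/
noncomputable def tupleAlgebra (ha : ∀ (a : S) (q : Q), step q a = some (ρ a q))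
    (hb : ∀ a a' : S, Commute (ρ a) (ρ a')) (b c : S) (m : ℕ) :
    Subsemigroup (ℕ × Q → AutomaticAlgebra step) where
  carrier := {x | (∃ k e, (m : ℤ) ∣ Finsupp.degree e - 1 ∧ x = stateTuple step ρ b c k e) ∨
    (∃ F : Finset ℕ, m ∣ F.card ∧ x = letterTuple step b c F) ∨ x = fun _ => zero}
  mul_mem' := by
    rintro _ _ (⟨k, e, he, rfl⟩ | ⟨F, hF, rfl⟩ | rfl) hy
    · rcases hy with ⟨k', e', he', rfl⟩ | ⟨F, hF, rfl⟩ | rfl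
      · exact Or.inr (Or.inr rfl)
      · refine Or.inl ⟨k + 1, e - finsetIndicator F, ?_, stateTuple_mul_letterTuple ha hb ..⟩
        rw [map_sub, degree_finsetIndicator, sub_right_comm]
        exact dvd_sub he (Int.natCast_dvd_natCast.2 hF)
      · exact Or.inr (Or.inr rfl)
    · exact Or.inr (Or.inr rfl)
    · exact Or.inr (Or.inr rfl)

end Tuples

open AutomaticAlgebra in
theorem theorem7p2 {Q : Type u} {S : Type v} [Finite Q] [Finite S]
    (step : Q → S → Option Q) (ρ : S → Equiv.Perm Q) (m : ℕ) (hm : 1 < m)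
    (ha : ∀ (a : S) (q : Q), step q a = some (ρ a q))
    (hb : ∀ a a' : S, Commute (ρ a) (ρ a'))
    (hc : ∃ b c : S, orderOf (ρ b * (ρ c)⁻¹) = m)
    (hd : ∀ C : (stateGraph step).ConnectedComponent,
      ¬ ∃ H : Subgroup (Equiv.Perm C.supp), H ≠ ⊥ ∧ Nat.card H ∣ m ∧
        ∃ g : Equiv.Perm C.supp, g • (H : Set (Equiv.Perm C.supp)) ⊆ letterActions step C.supp) :
    ¬ Dualizable (AutomaticAlgebra step) := by
  classical
  obtain ⟨b, c, hbc⟩ := hc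
  have hm0 : 0 < m := by omega
  let A := tupleAlgebra ha hb b c m
  have hstmem : ∀ k e, (m : ℤ) ∣ Finsupp.degree e - 1 → stateTuple step ρ b c k e ∈ A :=
    fun k e he => Or.inl ⟨k, e, he, rfl⟩
  have hltmem : ∀ F : Finset ℕ, m ∣ F.card → letterTuple step b c F ∈ A :=
    fun F hF => Or.inr (Or.inl ⟨F, hF, rfl⟩)
  let z : A := ⟨fun _ => zero, Or.inr (Or.inr rfl)⟩
  let t : ℕ → A := fun j => ⟨stateTuple step ρ b c 0 (Finsupp.single j 1), hstmem _ _ (by simp)⟩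
  have hISP : InISP (AutomaticAlgebra step) A := by
    refine ⟨ULift (ℕ × Q), ⟨fun x i => x.1 i.down, fun _ _ => rfl⟩, fun x x' h => ?_⟩
    exact Subtype.ext (funext fun i => congrFun h ⟨i⟩)
  have hmaj : ∀ x : A →ₙ* AutomaticAlgebra step, ∃ v, ∀ D : Finset ℕ,
      (∀ j ∈ D, x (t j) ≠ v) → D.card ≤ m * Nat.card Q := by
    intro x
    -- The default `zero` is harmless: `hmul` concerns only tuples in `A`, and in `hper` the two
    -- tuples coincide.
    let y : ℤ → (ℕ →₀ ℤ) → AutomaticAlgebra step := fun k e =>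
      if h : stateTuple step ρ b c k e ∈ A then x ⟨_, h⟩ else zero
    let l : Finset ℕ → AutomaticAlgebra step := fun F =>
      if h : letterTuple step b c F ∈ A then x ⟨_, h⟩ else zero
    have hmul : ∀ k e F, (m : ℤ) ∣ e.degree - 1 → m ∣ F.card →
        y k e * l F = y (k + 1) (e - finsetIndicator F) := by
      intro k e F he hF
      have h1 : y k e = _ := dif_pos (hstmem k e he)
      have h2 : l F = _ := dif_pos (hltmem F hF)
      have h3 := stateTuple_mul_letterTuple ha hb b c k e F
      have h4 : stateTuple step ρ b c (k + 1) (e - finsetIndicator F) ∈ A :=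
        h3 ▸ A.mul_mem (hstmem k e he) (hltmem F hF)
      have h5 : y (k + 1) (e - finsetIndicator F) = _ := dif_pos h4
      rw [h1, h2, h5, ← map_mul]
      exact congrArg x (Subtype.ext h3)
    have hper : ∀ k e i j,
        y k (e + m • (Finsupp.single j 1 - Finsupp.single i 1)) = y k e := by
      intro k e i j
      have : stateTuple step ρ b c k (e + m • (Finsupp.single j 1 - Finsupp.single i 1)) =
          stateTuple step ρ b c k e := by
        funext i'
        have hpow : (ρ b * (ρ c)⁻¹) ^ m = 1 := hbc ▸ pow_orderOf_eq_one _
        simp only [stateTuple, Finsupp.add_apply, Finsupp.smul_apply, zpow_add, nsmul_eq_mul,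
          zpow_mul, zpow_natCast, hpow, one_zpow, mul_one]
      simp only [y, this]
    obtain ⟨v, hv⟩ := exists_majority ha hb hm0 hd hmul hper
    refine ⟨v, fun D hD => hv D fun j hj => ?_⟩
    have : y 0 (Finsupp.single j 1) = x (t j) := dif_pos (t j).2
    rw [this]
    exact hD j hj
  choose v hv using hmaj
  have : Nonempty A := ⟨z⟩
  refine not_dualizable_of_ghost hISP t (m * Nat.card Q) v hv ?_
  rintro ⟨⟨a, haA⟩, hav⟩
  -- The projection to `(j, q)` takes the value `q` at all `t i` with `i ≠ j`, so an element
  -- representing `v` must be the limit tuple.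
  have hval : ∀ j q, a (j, q) = state q := by
    intro j q
    let π : A →ₙ* AutomaticAlgebra step := ⟨fun x => x.1 (j, q), fun _ _ => rfl⟩
    have hπ : ∀ i, i ≠ j → π (t i) = state q := by
      intro i hi
      change state _ = _
      simp [hi]
    by_contra hne
    have := hv π ((Finset.range (m * Nat.card Q + 2)).erase j) (fun i hi => by
      rw [hπ i (Finset.ne_of_mem_erase hi), hav π]
      exact Ne.symm hne)
    have h2 := Finset.pred_card_le_card_erase (s := Finset.range (m * Nat.card Q + 2)) (a := j)
    rw [Finset.card_range] at h2
    omega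
  obtain ⟨q₀⟩ : Nonempty Q := by
    by_contra hQ
    rw [not_nonempty_iff] at hQ
    rw [Subsingleton.elim (ρ b * (ρ c)⁻¹) 1, orderOf_one] at hbc
    omega
  rcases haA with ⟨k, e, he, rfl⟩ | ⟨F, -, rfl⟩ | rfl
  · have hone : ∀ j, ρ b ^ k * (ρ b * (ρ c)⁻¹) ^ e j = 1 := fun j =>
      Equiv.ext fun q => (state.injEq _ _).mp (hval j q)
    -- Outside the support of `e` only ρ_b ^ k remains, so it is trivial; then `m` divides every `e
    -- j`, against degree 1 mod `m`.
    obtain ⟨j₁, hj₁⟩ := Infinite.exists_notMem_finset e.support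
    have hk : ρ b ^ k = 1 := by
      simpa [Finsupp.notMem_support_iff.1 hj₁] using hone j₁
    have hdvd : ∀ j, (m : ℤ) ∣ e j := fun j => by
      rw [← hbc, orderOf_dvd_iff_zpow_eq_one]
      simpa [hk] using hone j
    have h1 : (m : ℤ) ∣ e.degree := Finset.dvd_sum fun j _ => hdvd j
    have h2 : (m : ℤ) ∣ 1 := by simpa using dvd_sub h1 he
    have := Int.le_of_dvd one_pos h2
    omega
  · exact absurd (hval 0 q₀) (by simp [letterTuple])
  · exact absurd (hval 0 q₀) (by simp)
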